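/- Let $n\ge 2$, $a,b\in\mathbb R^n$, and let $Q\in\mathbb R^{n\times n}$ be symmetric positive semidefinite (PSD). Write $\mathcal D=\{d\in\mathbb R^2: d_1\ge 0,\ d_2\ge 0,\ d_1d_2\ge 1\}$, and use the convention $c/0=\infty$ for $c>0$ and $0/0=0$, where a nonnegative coefficient multiplying a quotient is understood to be part of its numerator. For $d\in\mathcal D$, $x\in[0,1]^2$, $y\in\mathbb R_+^2$ let $$f(x,y,\lambda;d)=\frac{(d_1d_2-1)(d_1x_2y_1^2+d_2x_1y_2^2)+2\lambda d_1d_2y_1y_2+\lambda(d_1y_1^2+d_2y_2^2)}{(d_1d_2-1)x_1x_2-\lambda^2+\lambda(x_1+x_2)},$$ $$f_+^*(x,y;d)=\begin{cases}\frac{d_1y_1^2}{x_1}+\frac{d_2y_2^2}{x_2}&\text{if }x_1+x_2\le 1,\\ \frac{d_2y_2^2}{x_2}+\frac{d_1y_1^2}{1-x_2}&\text{if }0< x_1+x_2-1\le (x_1y_2-d_1x_2y_1)/y_2,\\ \frac{d_1y_1^2}{x_1}+\frac{d_2y_2^2}{1-x_1}&\text{if }0< x_1+x_2-1\le (x_2y_1-d_2x_1y_2)/y_1,\\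 f(x,y,x_1+x_2-1;d)&\text{otherwise,}\end{cases}$$ $$f_-^*(x,y;d)=\begin{cases}\frac{d_1y_1^2-2y_1y_2+y_2^2/d_1}{x_1}+\frac{y_2^2}{x_2}\left(d_2-\frac1{d_1}\right)&\text{if }x_1\ge x_2,\ d_1y_1\ge y_2,\\ \frac{d_1y_1^2-2y_1y_2+d_2y_2^2}{x_2}&\text{if }x_1\ge x_2,\ d_1y_1\le y_2,\\ \frac{d_1y_1^2-2y_1y_2+d_2y_2^2}{x_1}&\text{if }x_1\le x_2,\ y_1\ge d_2y_2,\\ \frac{y_1^2/d_2-2y_1y_2+d_2y_2^2}{x_2}+\frac{y_1^2}{x_1}\left(d_1-\frac1{d_2}\right)&\text{if }x_1\le x_2,\ y_1\le d_2y_2.\end{cases}$$ (The second condition in the definition of $f_+^*$ counts as violated when $y_2=0$, the third when $y_1=0$.) These functions describe, for the bivariate quadratics $d_1y_1^2\pm 2y_1y_2+d_2y_2^2$ with indicators, the closed convex hull of the mixed-integer epigraph. Let $\mathcal W$ be the set of points $(x_1,x_2,y_1,y_2,Y_{11},Y_{12},Y_{22})$ for which there is a symmetric matrix $W\in\mathbb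 R^{3\times 3}$, $W\succeq 0$, with $W_{12}=Y_{12}$; $(Y_{ii}-W_{ii})(x_i-W_{33})\ge (y_i-W_{3i})^2$, $W_{ii}\le Y_{ii}$, $W_{33}\le x_i$, $0\le W_{3i}\le y_i$ for $i=1,2$; and $W_{33}\ge x_1+x_2-1$. The relaxation $\mathsf{OptPairs}$ is $$\min\ a'x+b'y+\langle Q,Y\rangle\quad\text{s.t. } Y-yy'\succeq 0,\ (x_i,x_j,y_i,y_j,Y_{ii},Y_{ij},Y_{jj})\in\mathcal W\ \ \forall i<j,\ 0\le x\le 1,\ y\ge 0,$$ over $x,y\in\mathbb R^n$ and symmetric $Y\in\mathbb R^{n\times n}$. Consider any decomposition, valid for all $y\in\mathbb R^n$, $$y'Qy=y'Dy+\sum_{(i,j)\in\mathcal P}\alpha^+_{ij}\left(\beta^+_{ij}y_i^2+2y_iy_j+\gamma^+_{ij}y_j^2\right)+\sum_{(i,j)\in\mathcal N}\alpha^-_{ij}\left(\beta^-_{ij}y_i^2-2y_iy_j+\gamma^-_{ij}y_j^2\right)+y'Ry,$$ where $D$ is a diagonal PSD matrix, $R$ is a symmetric PSD matrix, $\mathcal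 P,\mathcal N$ are finite sets of pairs $(i,j)$ with $i\ne j$, $\alpha^\pm_{ij}>0$ and $(\beta^\pm_{ij},\gamma^\pm_{ij})\in\mathcal D$. The associated relaxation $\mathsf{Decomp}$ is $$\min\ a'x+b'y+\sum_{i=1}^n\frac{D_{ii}y_i^2}{x_i}+\sum_{(i,j)\in\mathcal P}\alpha^+_{ij}f_+^*(x_i,x_j,y_i,y_j;\beta^+_{ij},\gamma^+_{ij})+\sum_{(i,j)\in\mathcal N}\alpha^-_{ij}f_-^*(x_i,x_j,y_i,y_j;\beta^-_{ij},\gamma^-_{ij})+y'Ry\quad\text{s.t. }0\le x\le 1,\ y\ge 0.$$ Then, for every such decomposition, $\mathsf{OptPairs}$ is at least as strong as $\mathsf{Decomp}$: for every feasible $(x,y,Y)$ of $\mathsf{OptPairs}$, the point $(x,y)$ is feasible for $\mathsf{Decomp}$ and its $\mathsf{Decomp}$ objective value is at most the $\mathsf{OptPairs}$ objective value of $(x,y,Y)$; consequently the optimal value (infimum in $[-\infty,\infty]$) of $\mathsf{Decomp}$ is at most that of $\mathsf{OptPairs}$. -/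

import Mathlib

/-- Division extended to a zero denominator by the convention `c / 0 = ∞` for `c ≠ 0` and
`0 / 0 = 0`; it is used for `0 ≤ c` and `0 ≤ s`. -/
noncomputable def extDiv (c s : ℝ) : EReal :=
  if s = 0 then (if c = 0 then 0 else ⊤) else ((c / s : ℝ) : EReal)

/-- The set `𝒟` of coefficients `(d₁, d₂)`. -/
def coeffSet : Set (ℝ × ℝ) := {d | 0 ≤ d.1 ∧ 0 ≤ d.2 ∧ 1 ≤ d.1 * d.2}

/-- The function `f(x, y, l; d)`. -/
noncomputable def fAux (x₁ x₂ y₁ y₂ l d₁ d₂ : ℝ) : ℝ :=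
  ((d₁ * d₂ - 1) * (d₁ * x₂ * y₁ ^ 2 + d₂ * x₁ * y₂ ^ 2) + 2 * l * d₁ * d₂ * y₁ * y₂
      + l * (d₁ * y₁ ^ 2 + d₂ * y₂ ^ 2))
    / ((d₁ * d₂ - 1) * x₁ * x₂ - l ^ 2 + l * (x₁ + x₂))

open Classical in
/-- The function `f₊*(x, y; d)`.  The quotients in the second and third conditions are only reached
when `x₁ + x₂ - 1 > 0`; with `y₂ = 0` (resp. `y₁ = 0`) the quotient is `0` in Lean, the condition is
then false, which is the intended reading (the numerator is `≤ 0` there). -/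
noncomputable def fPlus (x₁ x₂ y₁ y₂ d₁ d₂ : ℝ) : EReal :=
  if x₁ + x₂ ≤ 1 then
    extDiv (d₁ * y₁ ^ 2) x₁ + extDiv (d₂ * y₂ ^ 2) x₂
  else if 0 ≤ x₁ + x₂ - 1 ∧ x₁ + x₂ - 1 ≤ (x₁ * y₂ - d₁ * x₂ * y₁) / y₂ then
    extDiv (d₂ * y₂ ^ 2) x₂ + extDiv (d₁ * y₁ ^ 2) (1 - x₂)
  else if 0 ≤ x₁ + x₂ - 1 ∧ x₁ + x₂ - 1 ≤ (x₂ * y₁ - d₂ * x₁ * y₂) / y₁ then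
    extDiv (d₁ * y₁ ^ 2) x₁ + extDiv (d₂ * y₂ ^ 2) (1 - x₁)
  else
    ((fAux x₁ x₂ y₁ y₂ (x₁ + x₂ - 1) d₁ d₂ : ℝ) : EReal)

open Classical in
/-- The function `f₋*(x, y; d)`.  The four pieces agree where their conditions overlap. -/
noncomputable def fMinus (x₁ x₂ y₁ y₂ d₁ d₂ : ℝ) : EReal :=
  if x₂ ≤ x₁ ∧ y₂ ≤ d₁ * y₁ then
    extDiv (d₁ * y₁ ^ 2 - 2 * y₁ * y₂ + y₂ ^ 2 / d₁) x₁ + extDiv ((d₂ - 1 / d₁) * y₂ ^ 2) x₂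
  else if x₂ ≤ x₁ ∧ d₁ * y₁ ≤ y₂ then
    extDiv (d₁ * y₁ ^ 2 - 2 * y₁ * y₂ + d₂ * y₂ ^ 2) x₂
  else if x₁ ≤ x₂ ∧ d₂ * y₂ ≤ y₁ then
    extDiv (d₁ * y₁ ^ 2 - 2 * y₁ * y₂ + d₂ * y₂ ^ 2) x₁
  else
    extDiv (y₁ ^ 2 / d₂ - 2 * y₁ * y₂ + d₂ * y₂ ^ 2) x₂ + extDiv ((d₁ - 1 / d₂) * y₁ ^ 2) x₁

/-- The set `𝒲` of points `(x₁, x₂, y₁, y₂, Y₁₁, Y₁₂, Y₂₂)`. -/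
def InW (x₁ x₂ y₁ y₂ Y₁₁ Y₁₂ Y₂₂ : ℝ) : Prop :=
  ∃ W : Matrix (Fin 3) (Fin 3) ℝ,
    W 0 1 = Y₁₂ ∧
    (y₁ - W 2 0) ^ 2 ≤ (Y₁₁ - W 0 0) * (x₁ - W 2 2) ∧ W 0 0 ≤ Y₁₁ ∧ W 2 2 ≤ x₁ ∧
    (y₂ - W 2 1) ^ 2 ≤ (Y₂₂ - W 1 1) * (x₂ - W 2 2) ∧ W 1 1 ≤ Y₂₂ ∧ W 2 2 ≤ x₂ ∧
    0 ≤ W 2 0 ∧ W 2 0 ≤ y₁ ∧ 0 ≤ W 2 1 ∧ W 2 1 ≤ y₂ ∧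
    x₁ + x₂ - 1 ≤ W 2 2 ∧
    W.PosSemidef

/-- Feasibility of `(x, y, Y)` in the relaxation `OptPairs`. -/
def OptPairsFeasible {n : ℕ} (x y : Fin n → ℝ) (Y : Matrix (Fin n) (Fin n) ℝ) : Prop :=
  (Y - Matrix.vecMulVec y y).PosSemidef ∧
  (∀ i j : Fin n, i < j → InW (x i) (x j) (y i) (y j) (Y i i) (Y i j) (Y j j)) ∧
  (∀ i, 0 ≤ x i ∧ x i ≤ 1) ∧ (∀ i, 0 ≤ y i)

/-- The objective `a'x + b'y + ⟨Q, Y⟩` of `OptPairs`. -/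
noncomputable def optPairsObjective {n : ℕ} (a b : Fin n → ℝ) (Q : Matrix (Fin n) (Fin n) ℝ)
    (x y : Fin n → ℝ) (Y : Matrix (Fin n) (Fin n) ℝ) : ℝ :=
  dotProduct a x + dotProduct b y + ∑ i, ∑ j, Q i j * Y i j

/-- The optimal value of `OptPairs`, an infimum in the extended reals. -/
noncomputable def optPairsValue {n : ℕ} (a b : Fin n → ℝ) (Q : Matrix (Fin n) (Fin n) ℝ) : EReal :=
  ⨅ (x : Fin n → ℝ) (y : Fin n → ℝ) (Y : Matrix (Fin n) (Fin n) ℝ) (_ : OptPairsFeasible x y Y),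
    ((optPairsObjective a b Q x y Y : ℝ) : EReal)

/-- A finite family of scaled bivariate terms `α (β yᵢ² ± 2 yᵢ yⱼ + γ yⱼ²)`, indexed by pairs `(i, j)`
of distinct indices, with `α > 0` and `(β, γ) ∈ 𝒟` (that is, convex); the sign is fixed where the
family is used. -/
structure BivariateTerms (n : ℕ) where
  pairs : Finset (Fin n × Fin n)
  α : Fin n × Fin n → ℝ
  β : Fin n × Fin n → ℝ
  γ : Fin n × Fin n → ℝ
  ne : ∀ p ∈ pairs, p.1 ≠ p.2
  α_pos : ∀ p ∈ pairs, 0 < α p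
  coeff_mem : ∀ p ∈ pairs, (β p, γ p) ∈ coeffSet

/-- A decomposition of `y'Qy` into a diagonal PSD part `D`, bivariate convex quadratics with positive
(`P`) and negative (`N`) off-diagonals, and a PSD remainder `R`. -/
structure QuadDecomposition {n : ℕ} (Q : Matrix (Fin n) (Fin n) ℝ) where
  D : Matrix (Fin n) (Fin n) ℝ
  P : BivariateTerms n
  N : BivariateTerms n
  R : Matrix (Fin n) (Fin n) ℝ
  D_diag : D.IsDiag
  D_psd : D.PosSemidef
  R_psd : R.PosSemidef
  decomp : ∀ y : Fin n → ℝ,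
    dotProduct y (Q.mulVec y) =
      dotProduct y (D.mulVec y)
        + ∑ p ∈ P.pairs,
            P.α p * (P.β p * y p.1 ^ 2 + 2 * y p.1 * y p.2 + P.γ p * y p.2 ^ 2)
        + ∑ p ∈ N.pairs,
            N.α p * (N.β p * y p.1 ^ 2 - 2 * y p.1 * y p.2 + N.γ p * y p.2 ^ 2)
        + dotProduct y (R.mulVec y)

/-- Feasibility of `(x, y)` in the relaxation `Decomp`. -/
def DecompFeasible {n : ℕ} (x y : Fin n → ℝ) : Prop :=
  (∀ i, 0 ≤ x i ∧ x i ≤ 1) ∧ (∀ i, 0 ≤ y i)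

/-- The objective of `Decomp` for the decomposition `δ`, with values in the extended reals. -/
noncomputable def decompObjective {n : ℕ} {Q : Matrix (Fin n) (Fin n) ℝ} (δ : QuadDecomposition Q)
    (a b : Fin n → ℝ) (x y : Fin n → ℝ) : EReal :=
  ((dotProduct a x + dotProduct b y : ℝ) : EReal)
    + ∑ i, extDiv (δ.D i i * y i ^ 2) (x i)
    + ∑ p ∈ δ.P.pairs, ((δ.P.α p : ℝ) : EReal)
        * fPlus (x p.1) (x p.2) (y p.1) (y p.2) (δ.P.β p) (δ.P.γ p)
    + ∑ p ∈ δ.N.pairs, ((δ.N.α p : ℝ) : EReal)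
        * fMinus (x p.1) (x p.2) (y p.1) (y p.2) (δ.N.β p) (δ.N.γ p)
    + ((dotProduct y (δ.R.mulVec y) : ℝ) : EReal)

/-- The optimal value of `Decomp`, an infimum in the extended reals. -/
noncomputable def decompValue {n : ℕ} {Q : Matrix (Fin n) (Fin n) ℝ} (δ : QuadDecomposition Q)
    (a b : Fin n → ℝ) : EReal :=
  ⨅ (x : Fin n → ℝ) (y : Fin n → ℝ) (_ : DecompFeasible x y), decompObjective δ a b x y

/-! The comparison is made term by term. Writing the PSD matrix `Y` as a sum of rank-one matrices
turns the decomposition of `y'Qy` into the same decomposition of `⟨Q, Y⟩`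
(`QuadDecomposition.sum_mul_eq`). The remainder is handled by `⟨R, Y - yy'⟩ ≥ 0`, the diagonal terms
by `InW.extDiv_le`. What remains is one inequality per pair: `d₁ Y₁₁ ± 2 Y₁₂ + d₂ Y₂₂` dominates
`f₊*` or `f₋*` on `𝒲`. Replacing the conic constraints on `W` by tangents gives lower bounds
depending only on `u = W₃₁`, `v = W₃₂`, `l = W₃₃` (`InW.exists_tangent_bound`). For fixed
multipliers such a bound is affine in `(u, v, l)`; each piece of `f₊*`, `f₋*` comes from a suitable
choice of multipliers together with the linear constraints on `u, v, l`. -/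

theorem extDiv_eq_coe_div {c s : ℝ} (h : s = 0 → c = 0) : extDiv c s = ((c / s : ℝ) : EReal) := by
  unfold extDiv
  split_ifs with h0 h1
  · simp [h0]
  · exact absurd (h h0) h1
  · rfl

/-- Tangent form of `b ^ 2 / c ≤ a`, with slope `s = b / c` at the optimum; it stays meaningful at
`c = 0`. -/
theorem two_mul_sub_mul_sq_le_of_sq_le_mul {a b c : ℝ} (ha : 0 ≤ a) (hc : 0 ≤ c)
    (h : b ^ 2 ≤ a * c) (s : ℝ) : 2 * s * b - c * s ^ 2 ≤ a := by
  rcases hc.eq_or_lt with rfl | hc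
  · have hb : b = 0 := by nlinarith
    simpa [hb] using ha
  · have : 0 ≤ c * (a - (2 * s * b - c * s ^ 2)) := by nlinarith [sq_nonneg (b - c * s)]
    linarith [nonneg_of_mul_nonneg_right this hc]

theorem Matrix.PosSemidef.quadratic_fin_three_nonneg {W : Matrix (Fin 3) (Fin 3) ℝ}
    (hW : W.PosSemidef) (a b c : ℝ) :
    0 ≤ W 0 0 * a ^ 2 + W 1 1 * b ^ 2 + W 2 2 * c ^ 2
      + 2 * W 0 1 * a * b + 2 * W 2 0 * a * c + 2 * W 2 1 * b * c := by
  have h := hW.dotProduct_mulVec_nonneg ![a, b, c]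
  have h01 : W 1 0 = W 0 1 := by simpa using hW.isHermitian.apply 0 1
  have h02 : W 0 2 = W 2 0 := by simpa using hW.isHermitian.apply 2 0
  have h12 : W 1 2 = W 2 1 := by simpa using hW.isHermitian.apply 2 1
  simp [dotProduct, Matrix.mulVec, Fin.sum_univ_three, h01, h02, h12] at h
  linarith

/-! ### Lower bounds valid on the set `𝒲`. -/

namespace InW

variable {x₁ x₂ y₁ y₂ Y₁₁ Y₁₂ Y₂₂ : ℝ}

theorem swap (h : InW x₁ x₂ y₁ y₂ Y₁₁ Y₁₂ Y₂₂) : InW x₂ x₁ y₂ y₁ Y₂₂ Y₁₂ Y₁₁ := by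
  obtain ⟨W, h01, h1, h2, h3, h4, h5, h6, h7, h8, h9, h10, h11, hW⟩ := h
  refine ⟨W.submatrix ![1, 0, 2] ![1, 0, 2], ?_, h4, h5, h6, h1, h2, h3, h9, h10, h7, h8, ?_,
    hW.submatrix _⟩
  · have : W 1 0 = W 0 1 := by simpa using hW.isHermitian.apply 0 1
    simpa [this] using h01
  · simpa [add_comm] using h11

/-- The tangent lower bounds on `d₁ Y₁₁ + 2 σ Y₁₂ + d₂ Y₂₂` given by multipliers `p, r, s₁, s₂`. -/
theorem exists_tangent_bound (h : InW x₁ x₂ y₁ y₂ Y₁₁ Y₁₂ Y₂₂) :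
    ∃ u v l : ℝ, 0 ≤ u ∧ u ≤ y₁ ∧ 0 ≤ v ∧ v ≤ y₂ ∧ 0 ≤ l ∧ l ≤ x₁ ∧ l ≤ x₂ ∧ x₁ + x₂ - 1 ≤ l ∧
      (l = 0 → u = 0 ∧ v = 0) ∧
      ∀ d₁ d₂ σ : ℝ, 0 < d₁ → 1 ≤ d₁ * d₂ → σ ^ 2 = 1 → ∀ p r s₁ s₂ : ℝ,
        2 * (d₁ * p * u + σ * (p * v + r * u) + d₂ * r * v)
            - l * (d₁ * p ^ 2 + 2 * σ * p * r + d₂ * r ^ 2)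
            + d₁ * (2 * s₁ * (y₁ - u) - (x₁ - l) * s₁ ^ 2)
            + d₂ * (2 * s₂ * (y₂ - v) - (x₂ - l) * s₂ ^ 2)
          ≤ d₁ * Y₁₁ + 2 * σ * Y₁₂ + d₂ * Y₂₂ := by
  obtain ⟨W, h01, h1, h2, h3, h4, h5, h6, h7, h8, h9, h10, h11, hW⟩ := h
  have hl : 0 ≤ W 2 2 := by simpa using hW.quadratic_fin_three_nonneg 0 0 1
  refine ⟨W 2 0, W 2 1, W 2 2, h7, h8, h9, h10, hl, h3, h6, h11, fun hl0 => ⟨?_, ?_⟩, ?_⟩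
  · have hA : 0 ≤ W 0 0 := by simpa using hW.quadratic_fin_three_nonneg 1 0 0
    -- With `W 2 2 = 0` the form at this vector equals `-(W 0 0 + 2) * W 2 0 ^ 2`.
    have := hW.quadratic_fin_three_nonneg (-W 2 0) 0 (W 0 0 + 1)
    rw [hl0] at this
    nlinarith [mul_nonneg hA (sq_nonneg (W 2 0))]
  · have hB : 0 ≤ W 1 1 := by simpa using hW.quadratic_fin_three_nonneg 0 1 0
    have := hW.quadratic_fin_three_nonneg 0 (-W 2 1) (W 1 1 + 1)
    rw [hl0] at this
    nlinarith [mul_nonneg hB (sq_nonneg (W 2 1))]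
  intro d₁ d₂ σ hd₁ hd hσ p r s₁ s₂
  have hd₂ : 0 < d₂ := by
    by_contra! hneg
    nlinarith
  have hk : 0 ≤ d₂ - 1 / d₁ := by
    rw [sub_nonneg, div_le_iff₀ hd₁]
    linarith
  have e1 := mul_le_mul_of_nonneg_left (two_mul_sub_mul_sq_le_of_sq_le_mul (sub_nonneg.2 h2)
    (sub_nonneg.2 h3) h1 s₁) hd₁.le
  have e2 := mul_le_mul_of_nonneg_left (two_mul_sub_mul_sq_le_of_sq_le_mul (sub_nonneg.2 h5)
    (sub_nonneg.2 h6) h4 s₂) hd₂.le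
  -- Completing the square, `d₁ a² + 2σab + d₂ b² = d₁ (a + σb/d₁)² + (d₂ - 1/d₁) b²`, applied to `a
  -- - p c` and `b - r c`; each square is a test vector for `W`.
  have q1 := mul_nonneg hd₁.le
    (hW.quadratic_fin_three_nonneg 1 (σ / d₁) (-(p + σ * r / d₁)))
  have q2 := mul_nonneg hk (hW.quadratic_fin_three_nonneg 0 1 (-r))
  have key : d₁ * (W 0 0 * 1 ^ 2 + W 1 1 * (σ / d₁) ^ 2 + W 2 2 * (-(p + σ * r / d₁)) ^ 2
        + 2 * W 0 1 * 1 * (σ / d₁) + 2 * W 2 0 * 1 * (-(p + σ * r / d₁))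
        + 2 * W 2 1 * (σ / d₁) * (-(p + σ * r / d₁)))
      + (d₂ - 1 / d₁) * (W 0 0 * 0 ^ 2 + W 1 1 * 1 ^ 2 + W 2 2 * (-r) ^ 2
        + 2 * W 0 1 * 0 * 1 + 2 * W 2 0 * 0 * (-r) + 2 * W 2 1 * 1 * (-r))
      = d₁ * W 0 0 + 2 * σ * W 0 1 + d₂ * W 1 1
        - (2 * (d₁ * p * W 2 0 + σ * (p * W 2 1 + r * W 2 0) + d₂ * r * W 2 1)
            - W 2 2 * (d₁ * p ^ 2 + 2 * σ * p * r + d₂ * r ^ 2)) := by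
    field_simp
    linear_combination (W 1 1 + W 2 2 * r ^ 2 - 2 * W 2 1 * r) * hσ
  rw [← h01]
  linarith

theorem sq_le_mul (h : InW x₁ x₂ y₁ y₂ Y₁₁ Y₁₂ Y₂₂) : y₁ ^ 2 ≤ Y₁₁ * x₁ ∧ 0 ≤ Y₁₁ := by
  obtain ⟨W, h01, h1, h2, h3, h4, h5, h6, h7, h8, h9, h10, h11, hW⟩ := h
  have e (t : ℝ) : 2 * t * y₁ - x₁ * t ^ 2 ≤ Y₁₁ := by
    have e1 := two_mul_sub_mul_sq_le_of_sq_le_mul (sub_nonneg.2 h2) (sub_nonneg.2 h3) h1 t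
    have q := hW.quadratic_fin_three_nonneg 1 0 (-t)
    linarith
  have h0 : 0 ≤ Y₁₁ := by simpa using e 0
  have hl : 0 ≤ W 2 2 := by simpa using hW.quadratic_fin_three_nonneg 0 0 1
  refine ⟨?_, h0⟩
  rcases (hl.trans h3).eq_or_lt with hx | hx
  -- When `x₁ = 0` the bound `e` is linear in `t`; this `t` makes its left side `Y₁₁ + 1` unless `y₁
  -- = 0`.
  · have := e ((Y₁₁ + 1) / 2 / y₁)
    by_cases hy : y₁ = 0
    · simp [hy, ← hx]
    · rw [← hx, show 2 * ((Y₁₁ + 1) / 2 / y₁) * y₁ = Y₁₁ + 1 by field_simp] at this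
      linarith
  · have := mul_le_mul_of_nonneg_right (e (y₁ / x₁)) hx.le
    field_simp at this
    linarith

/-- This rules out the value `∞` in the quotients over `xᵢ`, so they reduce to real division. -/
theorem eq_zero_of_eq_zero (h : InW x₁ x₂ y₁ y₂ Y₁₁ Y₁₂ Y₂₂) (hx : x₁ = 0) : y₁ = 0 := by
  have := h.sq_le_mul.1
  rw [hx, mul_zero] at this
  exact pow_eq_zero_iff two_ne_zero |>.1 (le_antisymm this (sq_nonneg _))

theorem extDiv_le (h : InW x₁ x₂ y₁ y₂ Y₁₁ Y₁₂ Y₂₂) (hx : 0 ≤ x₁) {c : ℝ} (hc : 0 ≤ c) :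
    extDiv (c * y₁ ^ 2) x₁ ≤ ((c * Y₁₁ : ℝ) : EReal) := by
  rw [extDiv_eq_coe_div fun h0 => by simp [h.eq_zero_of_eq_zero h0], EReal.coe_le_coe_iff,
    mul_div_assoc]
  exact mul_le_mul_of_nonneg_left (div_le_of_le_mul₀ hx h.sq_le_mul.2 h.sq_le_mul.1) hc

/-- The cross term `2uv/l` is nonnegative and can be dropped; convexity then gives `u²/l + (y₁ -
u)²/(x₁ - l) ≥ y₁²/x₁`, and likewise for index 2. -/
theorem div_add_div_le (h : InW x₁ x₂ y₁ y₂ Y₁₁ Y₁₂ Y₂₂) {d₁ d₂ : ℝ} (hd₁ : 0 < d₁)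
    (hd : 1 ≤ d₁ * d₂) :
    d₁ * y₁ ^ 2 / x₁ + d₂ * y₂ ^ 2 / x₂ ≤ d₁ * Y₁₁ + 2 * Y₁₂ + d₂ * Y₂₂ := by
  obtain ⟨t₁, ht₁⟩ : ∃ t, t = y₁ / x₁ := ⟨_, rfl⟩
  obtain ⟨t₂, ht₂⟩ : ∃ t, t = y₂ / x₂ := ⟨_, rfl⟩
  have e₁ : x₁ * t₁ = y₁ := by
    rw [ht₁]; exact mul_div_cancel_of_imp' h.eq_zero_of_eq_zero
  have e₂ : x₂ * t₂ = y₂ := by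
    rw [ht₂]; exact mul_div_cancel_of_imp' h.swap.eq_zero_of_eq_zero
  obtain ⟨u, v, l, hu, -, hv, -, hl, -, -, -, hl0, H⟩ := h.exists_tangent_bound
  have H := H d₁ d₂ 1 hd₁ hd (by norm_num) (u / l) (v / l) t₁ t₂
  have hd₂ : 0 ≤ d₂ := by
    by_contra! hneg
    nlinarith
  obtain ⟨p, hp⟩ : ∃ t, t = u / l := ⟨_, rfl⟩
  obtain ⟨r, hr⟩ : ∃ t, t = v / l := ⟨_, rfl⟩
  have e₃ : l * p = u := by
    rw [hp]; exact mul_div_cancel_of_imp' fun h => (hl0 h).1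
  have e₄ : l * r = v := by
    rw [hr]; exact mul_div_cancel_of_imp' fun h => (hl0 h).2
  rw [← hp, ← hr, ← e₃, ← e₄] at H
  have hp0 : 0 ≤ p := hp ▸ div_nonneg hu hl
  have hr0 : 0 ≤ r := hr ▸ div_nonneg hv hl
  have f₁ : d₁ * y₁ ^ 2 / x₁ = d₁ * y₁ * t₁ := by rw [ht₁]; ring
  have f₂ : d₂ * y₂ ^ 2 / x₂ = d₂ * y₂ * t₂ := by rw [ht₂]; ring
  rw [f₁, f₂]
  have g₁ := mul_nonneg (mul_nonneg hd₁.le hl) (sq_nonneg (p - t₁))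
  have g₂ := mul_nonneg (mul_nonneg hd₂ hl) (sq_nonneg (r - t₂))
  have g₃ := mul_nonneg hl (mul_nonneg hp0 hr0)
  linear_combination H + g₁ + g₂ + 2 * g₃ + d₁ * t₁ * e₁ + d₂ * t₂ * e₂

theorem div_add_div_one_sub_le (h : InW x₁ x₂ y₁ y₂ Y₁₁ Y₁₂ Y₂₂) {d₁ d₂ : ℝ} (hd₁ : 0 < d₁)
    (hd : 1 ≤ d₁ * d₂) (hx₂ : 0 < x₂) (hx₂' : x₂ ≤ 1) (hc : d₁ * x₂ * y₁ ≤ (1 - x₂) * y₂)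
    (h0 : 1 - x₂ = 0 → y₁ = 0) :
    d₂ * y₂ ^ 2 / x₂ + d₁ * y₁ ^ 2 / (1 - x₂) ≤ d₁ * Y₁₁ + 2 * Y₁₂ + d₂ * Y₂₂ := by
  obtain ⟨s, hs⟩ : ∃ t, t = y₁ / (1 - x₂) := ⟨_, rfl⟩
  obtain ⟨t, ht⟩ : ∃ t, t = y₂ / x₂ := ⟨_, rfl⟩
  have e₁ : (1 - x₂) * s = y₁ := by
    rw [hs]; exact mul_div_cancel_of_imp' h0
  have e₂ : x₂ * t = y₂ := by
    rw [ht]; exact mul_div_cancel₀ _ hx₂.ne'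
  obtain ⟨u, v, l, hu, -, hv, hv', -, -, -, hl, -, H⟩ := h.exists_tangent_bound
  -- The coefficient of `u` is `2(t - d₁ s) ≥ 0`, that of `v` is `0`, that of `l` is `d₁ s²`: the
  -- worst case is `u = 0`, `l = x₁ + x₂ - 1`.
  have H := H d₁ d₂ 1 hd₁ hd (by norm_num) 0 t s t
  have hts : 0 ≤ t - d₁ * s := by
    rcases (sub_nonneg.2 hx₂').eq_or_lt with h1 | h1
    · rw [hs, ← h1, div_zero, ht]
      simpa using div_nonneg (hv.trans hv') hx₂.le
    · rw [← e₁, ← e₂] at hc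
      have : 0 ≤ (x₂ * (1 - x₂)) * (t - d₁ * s) := by linarith
      exact nonneg_of_mul_nonneg_right this (mul_pos hx₂ h1)
  have f₁ : d₁ * y₁ ^ 2 / (1 - x₂) = d₁ * y₁ * s := by rw [hs]; ring
  have f₂ : d₂ * y₂ ^ 2 / x₂ = d₂ * y₂ * t := by rw [ht]; ring
  rw [f₁, f₂]
  have g₁ := mul_nonneg hu hts
  have g₂ := mul_nonneg (mul_nonneg hd₁.le (sq_nonneg s)) (sub_nonneg.2 hl)
  linear_combination H + 2 * g₁ + g₂ + d₁ * s * e₁ + d₂ * t * e₂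

theorem fAux_le (h : InW x₁ x₂ y₁ y₂ Y₁₁ Y₁₂ Y₂₂) {d₁ d₂ : ℝ} (hd₁ : 0 < d₁)
    (hd : 1 ≤ d₁ * d₂) (hx₁ : 0 ≤ x₁) (hx₂ : 0 ≤ x₂) (hx : 1 < x₁ + x₂)
    (h₁ : (1 - x₂) * y₂ ≤ d₁ * x₂ * y₁) (h₂ : (1 - x₁) * y₁ ≤ d₂ * x₁ * y₂) :
    fAux x₁ x₂ y₁ y₂ (x₁ + x₂ - 1) d₁ d₂ ≤ d₁ * Y₁₁ + 2 * Y₁₂ + d₂ * Y₂₂ := by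
  have hd₂ : 0 < d₂ := by
    by_contra! hneg
    nlinarith
  obtain ⟨Δ, hΔ⟩ : ∃ Δ, Δ = d₁ * d₂ * x₁ * x₂ - (1 - x₁) * (1 - x₂) := ⟨_, rfl⟩
  have hΔ0 : 0 < Δ := by
    have := mul_nonneg (sub_nonneg.2 hd) (mul_nonneg hx₁ hx₂)
    rw [hΔ]
    linarith
  -- `p, r` solve the linear system `e₁`, `e₂` by Cramer's rule, up to scaling of the equations; it
  -- says `y₁ = l p + (x₁ - l) s₁` and `y₂ = l r + (x₂ - l) s₂` at `l = x₁ + x₂ - 1`. The failed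
  -- case conditions give `p, r ≥ 0`.
  obtain ⟨p, hp⟩ : ∃ p, p = d₂ * (d₁ * x₂ * y₁ - (1 - x₂) * y₂) / Δ := ⟨_, rfl⟩
  obtain ⟨r, hr⟩ : ∃ r, r = d₁ * (d₂ * x₁ * y₂ - (1 - x₁) * y₁) / Δ := ⟨_, rfl⟩
  have hp0 : 0 ≤ p := hp ▸ div_nonneg (mul_nonneg hd₂.le (sub_nonneg.2 h₁)) hΔ0.le
  have hr0 : 0 ≤ r := hr ▸ div_nonneg (mul_nonneg hd₁.le (sub_nonneg.2 h₂)) hΔ0.le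
  have e₁ : d₁ * x₁ * p + (1 - x₂) * r = d₁ * y₁ := by
    rw [hp, hr]
    field_simp
    rw [hΔ]
    ring
  have e₂ : d₂ * x₂ * r + (1 - x₁) * p = d₂ * y₂ := by
    rw [hp, hr]
    field_simp
    rw [hΔ]
    ring
  have hf : fAux x₁ x₂ y₁ y₂ (x₁ + x₂ - 1) d₁ d₂ = (d₁ * p + r) * y₁ + (d₂ * r + p) * y₂ := by
    rw [fAux, show (d₁ * d₂ - 1) * x₁ * x₂ - (x₁ + x₂ - 1) ^ 2 + (x₁ + x₂ - 1) * (x₁ + x₂) = Δ by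
      rw [hΔ]; ring, hp, hr]
    field_simp
    ring
  obtain ⟨u, v, l, -, -, -, -, -, -, -, hl, -, H⟩ := h.exists_tangent_bound
  -- These values cancel the coefficients of `u` and `v`; that of `l` becomes `s₁ r + s₂ p ≥ 0`.
  obtain ⟨s₁, hs₁⟩ : ∃ s, s = p + r / d₁ := ⟨_, rfl⟩
  obtain ⟨s₂, hs₂⟩ : ∃ s, s = r + p / d₂ := ⟨_, rfl⟩
  have H := H d₁ d₂ 1 hd₁ hd (by norm_num) p r s₁ s₂
  have c₁ : d₁ * s₁ = d₁ * p + r := by rw [hs₁]; field_simp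
  have c₂ : d₂ * s₂ = d₂ * r + p := by rw [hs₂]; field_simp
  have g : 0 ≤ (l - (x₁ + x₂ - 1)) * (s₁ * r + s₂ * p) := by
    have : 0 ≤ s₁ * r + s₂ * p := by rw [hs₁, hs₂]; positivity
    exact mul_nonneg (sub_nonneg.2 hl) this
  rw [hf]
  linear_combination H + g + (-y₁ + 2 * u + x₁ * s₁ - l * (s₁ + p)) * c₁
    + (-y₂ + 2 * v + x₂ * s₂ - l * (s₂ + r)) * c₂ + s₁ * e₁ + s₂ * e₂

/-- The bound for the pieces of `f₋*` in which `W₃₃ = x₂` and `W₃₂ = y₂`. -/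
theorem div_add_div_le_neg (h : InW x₁ x₂ y₁ y₂ Y₁₁ Y₁₂ Y₂₂) {d₁ d₂ : ℝ} (hd₁ : 0 < d₁)
    (hd : 1 ≤ d₁ * d₂) (hx : x₂ ≤ x₁) (hy : y₂ ≤ d₁ * y₁) :
    (d₁ * y₁ ^ 2 - 2 * y₁ * y₂ + y₂ ^ 2 / d₁) / x₁ + (d₂ - 1 / d₁) * y₂ ^ 2 / x₂
      ≤ d₁ * Y₁₁ - 2 * Y₁₂ + d₂ * Y₂₂ := by
  have hd₂ : 0 < d₂ := by
    by_contra! hneg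
    nlinarith
  obtain ⟨u, v, l, -, -, hv, hv', hl, hl₁, hl₂, -, -, H⟩ := h.exists_tangent_bound
  obtain ⟨r, hr⟩ : ∃ r, r = y₂ / x₂ := ⟨_, rfl⟩
  obtain ⟨s, hs⟩ : ∃ s, s = (y₁ - y₂ / d₁) / x₁ := ⟨_, rfl⟩
  have e₂ : x₂ * r = y₂ := by
    rw [hr]; exact mul_div_cancel_of_imp' h.swap.eq_zero_of_eq_zero
  obtain ⟨w, hw⟩ : ∃ w, w = r / d₁ := ⟨_, rfl⟩
  obtain ⟨k, hk⟩ : ∃ k, k = 1 - 1 / (d₁ * d₂) := ⟨_, rfl⟩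
  obtain ⟨m, hm⟩ : ∃ m, m = k * r := ⟨_, rfl⟩
  have ew : d₁ * w = r := by rw [hw]; field_simp
  have em : d₂ * m = d₂ * r - w := by rw [hm, hk, hw]; field_simp
  have hz : y₂ / d₁ = x₂ * w := by rw [hw, ← e₂]; ring
  have e₁ : x₁ * s = y₁ - x₂ * w := by
    rw [hs, ← hz]
    refine mul_div_cancel_of_imp' fun h0 => ?_
    rw [h.eq_zero_of_eq_zero h0, h.swap.eq_zero_of_eq_zero (by linarith)]
    simp
  have hs0 : 0 ≤ s := hs ▸ div_nonneg (sub_nonneg.2 <| (div_le_iff₀' hd₁).2 hy) (hl.trans hl₁)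
  have hk0 : 0 ≤ k := by
    rw [hk, sub_nonneg]
    exact div_le_one_of_le₀ hd (by positivity)
  have hk1 : 0 ≤ 1 - k := by
    rw [hk, sub_sub_cancel]
    positivity
  -- Now `u` has coefficient `0`, `v` has `-2s ≤ 0` and `l` has `-d₂ m (r - m) ≤ 0`, so the worst
  -- case is `v = y₂`, `l = x₂`.
  have H := H d₁ d₂ (-1) hd₁ hd (by norm_num) (s + w) r s m
  have f₁ : (d₁ * y₁ ^ 2 - 2 * y₁ * y₂ + y₂ ^ 2 / d₁) / x₁ = d₁ * x₁ * s ^ 2 := by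
    rcases (hl.trans hl₁).eq_or_lt with h0 | h0
    · simp [← h0]
    · rw [hs]; field_simp; ring
  have f₂ : (d₂ - 1 / d₁) * y₂ ^ 2 / x₂ = d₂ * m * y₂ := by
    rw [em, hw, hr]; ring
  rw [f₁, f₂]
  have g₁ := mul_nonneg hs0 (sub_nonneg.2 hv')
  have g₂ : 0 ≤ (x₂ - l) * (d₂ * m * (r - m)) := by
    rw [show d₂ * m * (r - m) = d₂ * r ^ 2 * k * (1 - k) by rw [hm]; ring]
    have := sub_nonneg.2 hl₂
    positivity
  linear_combination H + 2 * g₁ + g₂ + (-2 * u + l * (w + 2 * s) - 2 * s * x₂) * ew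
    + (2 * v - l * r) * em + 2 * d₁ * s * e₁ + (d₂ * m - 2 * s) * e₂

/-- The bound for the pieces of `f₋*` in which moreover `W₃₁ = y₁`. -/
theorem div_le_neg (h : InW x₁ x₂ y₁ y₂ Y₁₁ Y₁₂ Y₂₂) {d₁ d₂ : ℝ} (hd₁ : 0 < d₁)
    (hd : 1 ≤ d₁ * d₂) (hy : d₁ * y₁ ≤ y₂) :
    (d₁ * y₁ ^ 2 - 2 * y₁ * y₂ + d₂ * y₂ ^ 2) / x₂ ≤ d₁ * Y₁₁ - 2 * Y₁₂ + d₂ * Y₂₂ := by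
  have hd₂ : 0 < d₂ := by
    by_contra! hneg
    nlinarith
  obtain ⟨u, v, l, hu, hu', -, -, hl, -, hl₂, -, -, H⟩ := h.exists_tangent_bound
  obtain ⟨r, hr⟩ : ∃ r, r = y₂ / x₂ := ⟨_, rfl⟩
  obtain ⟨p, hp⟩ : ∃ p, p = y₁ / x₂ := ⟨_, rfl⟩
  obtain ⟨w, hw⟩ : ∃ w, w = 1 / d₂ := ⟨_, rfl⟩
  have e₂ : x₂ * r = y₂ := by
    rw [hr]; exact mul_div_cancel_of_imp' h.swap.eq_zero_of_eq_zero
  have e₁ : x₂ * p = y₁ := by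
    rw [hp]
    refine mul_div_cancel_of_imp' fun h0 => ?_
    rw [h.swap.eq_zero_of_eq_zero h0] at hy
    exact le_antisymm (nonpos_of_mul_nonpos_right hy hd₁) (hu.trans hu')
  have c : d₂ * w = 1 := by rw [hw]; field_simp
  -- Here `v` cancels, while `u` and `l` have the nonpositive coefficients `2(d₁ p - r)` and `-p²
  -- (d₁ - w)`.
  have H := H d₁ d₂ (-1) hd₁ hd (by norm_num) p r 0 (r - p * w)
  have f : (d₁ * y₁ ^ 2 - 2 * y₁ * y₂ + d₂ * y₂ ^ 2) / x₂
      = x₂ * (d₁ * p ^ 2 - 2 * p * r + d₂ * r ^ 2) := by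
    rcases (hl.trans hl₂).eq_or_lt with h0 | h0
    · simp [← h0]
    · rw [hp, hr]; field_simp
  have hr' : 0 ≤ r - d₁ * p := by
    rw [hr, hp, ← mul_div_assoc, ← sub_div]
    exact div_nonneg (sub_nonneg.2 hy) (hl.trans hl₂)
  have hw' : 0 ≤ d₁ - w := by
    rw [hw, sub_nonneg]
    exact (div_le_iff₀ hd₂).2 hd
  have g₁ := mul_nonneg (sub_nonneg.2 hu') hr'
  have g₂ := mul_nonneg (sub_nonneg.2 hl₂) (mul_nonneg (sq_nonneg p) hw')
  rw [f]
  rw [← e₁, ← e₂] at H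
  rw [← e₁] at g₁
  linear_combination H + 2 * g₁ + g₂
    + (-2 * v * p + l * (2 * p * r - p ^ 2 * w) + x₂ * p ^ 2 * w) * c

/-! ### Assembling the pieces of `f₊*` and `f₋*`; symmetric pieces follow by `swap`. -/

theorem fPlus_le (h : InW x₁ x₂ y₁ y₂ Y₁₁ Y₁₂ Y₂₂) (hx₁ : 0 ≤ x₁ ∧ x₁ ≤ 1)
    (hx₂ : 0 ≤ x₂ ∧ x₂ ≤ 1) (hy₁ : 0 ≤ y₁) (hy₂ : 0 ≤ y₂) {d₁ d₂ : ℝ} (hd₁ : 0 < d₁)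
    (hd₂ : 0 < d₂) (hd : 1 ≤ d₁ * d₂) :
    fPlus x₁ x₂ y₁ y₂ d₁ d₂ ≤ ((d₁ * Y₁₁ + 2 * Y₁₂ + d₂ * Y₂₂ : ℝ) : EReal) := by
  have hd' : 1 ≤ d₂ * d₁ := by rwa [mul_comm]
  have k₁ := h.eq_zero_of_eq_zero
  have k₂ := h.swap.eq_zero_of_eq_zero
  unfold fPlus
  split_ifs with c₁ c₂ c₃
  · rw [extDiv_eq_coe_div fun h0 => by simp [k₁ h0], extDiv_eq_coe_div fun h0 => by simp [k₂ h0],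
      ← EReal.coe_add, EReal.coe_le_coe_iff]
    exact h.div_add_div_le hd₁ hd
  · have hx : 0 < x₂ := by linarith
    have hy : 0 < y₂ := hy₂.lt_of_ne fun h0 => by
      rw [← h0, div_zero] at c₂
      linarith [c₂.2]
    have hc : d₁ * x₂ * y₁ ≤ (1 - x₂) * y₂ := by
      have := (le_div_iff₀ hy).1 c₂.2
      linarith
    have h0 : 1 - x₂ = 0 → y₁ = 0 := fun h0 => by
      rw [h0, zero_mul] at hc
      exact le_antisymm (nonpos_of_mul_nonpos_right hc (mul_pos hd₁ hx)) hy₁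
    rw [extDiv_eq_coe_div fun h0 => by simp [k₂ h0], extDiv_eq_coe_div fun h' => by simp [h0 h'],
      ← EReal.coe_add, EReal.coe_le_coe_iff]
    exact h.div_add_div_one_sub_le hd₁ hd hx hx₂.2 hc h0
  · have hx : 0 < x₁ := by linarith
    have hy : 0 < y₁ := hy₁.lt_of_ne fun h0 => by
      rw [← h0, div_zero] at c₃
      linarith [c₃.2]
    have hc : d₂ * x₁ * y₂ ≤ (1 - x₁) * y₁ := by
      have := (le_div_iff₀ hy).1 c₃.2
      linarith
    have h0 : 1 - x₁ = 0 → y₂ = 0 := fun h0 => by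
      rw [h0, zero_mul] at hc
      exact le_antisymm (nonpos_of_mul_nonpos_right hc (mul_pos hd₂ hx)) hy₂
    rw [extDiv_eq_coe_div fun h0 => by simp [k₁ h0], extDiv_eq_coe_div fun h' => by simp [h0 h'],
      ← EReal.coe_add, EReal.coe_le_coe_iff]
    linarith [h.swap.div_add_div_one_sub_le hd₂ hd' hx hx₁.2 hc h0]
  · rw [EReal.coe_le_coe_iff]
    have hx0 : 0 ≤ x₁ + x₂ - 1 := by linarith
    refine h.fAux_le hd₁ hd hx₁.1 hx₂.1 (not_le.1 c₁) ?_ ?_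
    · rcases hy₂.eq_or_lt with h0 | h0
      · rw [← h0, mul_zero]
        exact mul_nonneg (mul_nonneg hd₁.le hx₂.1) hy₁
      · have := fun hle => c₂ ⟨hx0, (le_div_iff₀ h0).2 hle⟩
        linarith [not_le.1 this]
    · rcases hy₁.eq_or_lt with h0 | h0
      · rw [← h0, mul_zero]
        exact mul_nonneg (mul_nonneg hd₂.le hx₁.1) hy₂
      · have := fun hle => c₃ ⟨hx0, (le_div_iff₀ h0).2 hle⟩
        linarith [not_le.1 this]

theorem fMinus_le (h : InW x₁ x₂ y₁ y₂ Y₁₁ Y₁₂ Y₂₂) (hx₁ : 0 ≤ x₁) (hx₂ : 0 ≤ x₂)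
    (hy₁ : 0 ≤ y₁) (hy₂ : 0 ≤ y₂) {d₁ d₂ : ℝ} (hd₁ : 0 < d₁)
    (hd₂ : 0 < d₂) (hd : 1 ≤ d₁ * d₂) :
    fMinus x₁ x₂ y₁ y₂ d₁ d₂ ≤ ((d₁ * Y₁₁ - 2 * Y₁₂ + d₂ * Y₂₂ : ℝ) : EReal) := by
  have hd' : 1 ≤ d₂ * d₁ := by rwa [mul_comm]
  have k₁ := h.eq_zero_of_eq_zero
  have k₂ := h.swap.eq_zero_of_eq_zero
  unfold fMinus
  split_ifs with c₁ c₂ c₃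
  · rw [extDiv_eq_coe_div fun h0 => by simp [k₁ h0, k₂ (by linarith : x₂ = 0)],
      extDiv_eq_coe_div fun h0 => by simp [k₂ h0], ← EReal.coe_add, EReal.coe_le_coe_iff]
    exact h.div_add_div_le_neg hd₁ hd c₁.1 c₁.2
  · rw [extDiv_eq_coe_div, EReal.coe_le_coe_iff]
    · exact h.div_le_neg hd₁ hd c₂.2
    · intro h0
      have hy := c₂.2
      rw [k₂ h0] at hy ⊢
      simp [le_antisymm (nonpos_of_mul_nonpos_right hy hd₁) hy₁]
  · rw [extDiv_eq_coe_div, EReal.coe_le_coe_iff]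
    · refine (le_of_eq ?_).trans ((h.swap.div_le_neg hd₂ hd' c₃.2).trans_eq (by ring))
      ring
    · intro h0
      have hy := c₃.2
      rw [k₁ h0] at hy ⊢
      simp [le_antisymm (nonpos_of_mul_nonpos_right hy hd₂) hy₂]
  -- The last branch carries no condition of its own; it is recovered from the failure of the other
  -- three.
  · have hx : x₁ ≤ x₂ := by
      by_contra! hlt
      rcases le_total y₂ (d₁ * y₁) with h' | h'
      · exact c₁ ⟨hlt.le, h'⟩
      · exact c₂ ⟨hlt.le, h'⟩
    have hy : y₁ ≤ d₂ * y₂ := (not_le.1 fun hle => c₃ ⟨hx, hle⟩).le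
    rw [extDiv_eq_coe_div fun h0 => by simp [k₂ h0, k₁ (by linarith : x₁ = 0)],
      extDiv_eq_coe_div fun h0 => by simp [k₁ h0], ← EReal.coe_add, EReal.coe_le_coe_iff]
    refine (le_of_eq ?_).trans ((h.swap.div_add_div_le_neg hd₂ hd' hx hy).trans_eq (by ring))
    ring

end InW

theorem pos_of_mem_coeffSet {d₁ d₂ : ℝ} (h : (d₁, d₂) ∈ coeffSet) :
    0 < d₁ ∧ 0 < d₂ ∧ 1 ≤ d₁ * d₂ := by
  obtain ⟨h₁, h₂, h₃⟩ := h
  simp only at h₁ h₂ h₃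
  refine ⟨h₁.lt_of_ne ?_, h₂.lt_of_ne ?_, h₃⟩ <;> rintro rfl <;> norm_num at h₃

/-! ### Lifting quadratic forms to PSD matrices. -/

open scoped MatrixOrder in
/-- A positive semidefinite matrix is a sum of rank one matrices. -/
theorem Matrix.PosSemidef.exists_apply_eq_sum {n : ℕ} {Y : Matrix (Fin n) (Fin n) ℝ}
    (hY : Y.PosSemidef) :
    ∃ z : Fin n → Fin n → ℝ, ∀ i j, Y i j = ∑ k, z k i * z k j := by
  classical
  obtain ⟨B, rfl⟩ := CStarAlgebra.nonneg_iff_eq_star_mul_self.1 hY.nonneg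
  exact ⟨B, fun i j => by simp [Matrix.mul_apply, Matrix.star_eq_conjTranspose]⟩

theorem sum_dotProduct_mulVec_eq {n : ℕ} (M : Matrix (Fin n) (Fin n) ℝ) {z : Fin n → Fin n → ℝ}
    {Y : Matrix (Fin n) (Fin n) ℝ} (hz : ∀ i j, Y i j = ∑ k, z k i * z k j) :
    ∑ k, dotProduct (z k) (M.mulVec (z k)) = ∑ i, ∑ j, M i j * Y i j := by
  simp only [hz, dotProduct, Matrix.mulVec, Finset.mul_sum]
  rw [Finset.sum_comm]
  refine Finset.sum_congr rfl fun i _ => ?_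
  rw [Finset.sum_comm]
  refine Finset.sum_congr rfl fun j _ => Finset.sum_congr rfl fun k _ => by ring

theorem Matrix.PosSemidef.sum_mul_nonneg {n : ℕ} {M Y : Matrix (Fin n) (Fin n) ℝ}
    (hM : M.PosSemidef) (hY : Y.PosSemidef) : 0 ≤ ∑ i, ∑ j, M i j * Y i j := by
  obtain ⟨z, hz⟩ := hY.exists_apply_eq_sum
  rw [← sum_dotProduct_mulVec_eq M hz]
  exact Finset.sum_nonneg fun k _ => by simpa using hM.dotProduct_mulVec_nonneg (z k)

theorem sum_vecMulVec_eq {n : ℕ} (M : Matrix (Fin n) (Fin n) ℝ) (y : Fin n → ℝ) :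
    ∑ i, ∑ j, M i j * Matrix.vecMulVec y y i j = dotProduct y (M.mulVec y) := by
  simp only [Matrix.vecMulVec_apply, dotProduct, Matrix.mulVec, Finset.mul_sum]
  exact Finset.sum_congr rfl fun i _ => Finset.sum_congr rfl fun j _ => by ring

/-- The decomposition of the quadratic form extends to the lifted variable. -/
theorem QuadDecomposition.sum_mul_eq {n : ℕ} {Q : Matrix (Fin n) (Fin n) ℝ}
    (δ : QuadDecomposition Q) {Y : Matrix (Fin n) (Fin n) ℝ} (hY : Y.PosSemidef) :
    ∑ i, ∑ j, Q i j * Y i j = ∑ i, δ.D i i * Y i i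
      + ∑ p ∈ δ.P.pairs,
          δ.P.α p * (δ.P.β p * Y p.1 p.1 + 2 * Y p.1 p.2 + δ.P.γ p * Y p.2 p.2)
      + ∑ p ∈ δ.N.pairs,
          δ.N.α p * (δ.N.β p * Y p.1 p.1 - 2 * Y p.1 p.2 + δ.N.γ p * Y p.2 p.2)
      + ∑ i, ∑ j, δ.R i j * Y i j := by
  obtain ⟨z, hz⟩ := hY.exists_apply_eq_sum
  have hD : ∑ i, δ.D i i * Y i i = ∑ i, ∑ j, δ.D i j * Y i j :=
    Finset.sum_congr rfl fun i _ => Eq.symm <|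
      Finset.sum_eq_single i (fun j _ hj => by rw [δ.D_diag hj.symm, zero_mul]) (by simp)
  -- Apply the identity of quadratic forms at each vector `z k` and sum over `k`.
  rw [hD, ← sum_dotProduct_mulVec_eq Q hz, ← sum_dotProduct_mulVec_eq δ.D hz,
    ← sum_dotProduct_mulVec_eq δ.R hz, Finset.sum_congr rfl fun k _ => δ.decomp (z k)]
  simp only [Finset.sum_add_distrib]
  congr 2
  · congr 1
    rw [Finset.sum_comm]
    refine Finset.sum_congr rfl fun p _ => ?_
    simp only [hz, Finset.mul_sum, ← Finset.sum_add_distrib]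
    exact Finset.sum_congr rfl fun k _ => by ring
  · rw [Finset.sum_comm]
    refine Finset.sum_congr rfl fun p _ => ?_
    simp only [hz, Finset.mul_sum, ← Finset.sum_add_distrib, ← Finset.sum_sub_distrib]
    exact Finset.sum_congr rfl fun k _ => by ring

namespace OptPairsFeasible

variable {n : ℕ} {x y : Fin n → ℝ} {Y : Matrix (Fin n) (Fin n) ℝ}

theorem posSemidef (h : OptPairsFeasible x y Y) : Y.PosSemidef := by
  have := h.1.add (Matrix.posSemidef_vecMulVec_self_star y)
  simpa using this

/-- Pairs in a decomposition may come in either order, while the constraints are imposed for `i < j`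
only. -/
theorem inW (h : OptPairsFeasible x y Y) {i j : Fin n} (hij : i ≠ j) :
    InW (x i) (x j) (y i) (y j) (Y i i) (Y i j) (Y j j) := by
  rcases lt_or_gt_of_ne hij with hlt | hlt
  · exact h.2.1 i j hlt
  · have : Y i j = Y j i := by simpa using h.posSemidef.isHermitian.apply j i
    rw [this]
    exact (h.2.1 j i hlt).swap

end OptPairsFeasible

/-! ### Comparison of the two relaxations. -/

theorem EReal.sum_le_coe_sum {ι : Type*} {s : Finset ι} {f : ι → EReal} {g : ι → ℝ}
    (h : ∀ i ∈ s, f i ≤ (g i : EReal)) : ∑ i ∈ s, f i ≤ ((∑ i ∈ s, g i : ℝ) : EReal) := by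
  classical
  induction s using Finset.induction_on with
  | empty => simp
  | insert i s hi ih =>
    rw [Finset.sum_insert hi, Finset.sum_insert hi, EReal.coe_add]
    exact add_le_add (h i (Finset.mem_insert_self i s))
      (ih fun j hj => h j (Finset.mem_insert_of_mem hj))

theorem EReal.coe_mul_le_coe_mul {a b : ℝ} {f : EReal} (ha : 0 ≤ a) (h : f ≤ (b : EReal)) :
    (a : EReal) * f ≤ ((a * b : ℝ) : EReal) := by
  rw [EReal.coe_mul]
  exact mul_le_mul_of_nonneg_left h (EReal.coe_nonneg.2 ha)

theorem decompObjective_le_optPairsObjective {n : ℕ} (hn : 2 ≤ n) (a b : Fin n → ℝ)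
    {Q : Matrix (Fin n) (Fin n) ℝ} (δ : QuadDecomposition Q) {x y : Fin n → ℝ}
    {Y : Matrix (Fin n) (Fin n) ℝ} (h : OptPairsFeasible x y Y) :
    decompObjective δ a b x y ≤ ((optPairsObjective a b Q x y Y : ℝ) : EReal) := by
  have : Nontrivial (Fin n) := Fin.nontrivial_iff_two_le.2 hn
  have hx := h.2.2.1
  have hy := h.2.2.2
  have hR : dotProduct y (δ.R.mulVec y) ≤ ∑ i, ∑ j, δ.R i j * Y i j := by
    rw [← sum_vecMulVec_eq, ← sub_nonneg, ← Finset.sum_sub_distrib]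
    refine (δ.R_psd.sum_mul_nonneg h.1).trans_eq (Finset.sum_congr rfl fun i _ => ?_)
    rw [← Finset.sum_sub_distrib]
    exact Finset.sum_congr rfl fun j _ => by rw [Matrix.sub_apply, mul_sub]
  rw [decompObjective, optPairsObjective, δ.sum_mul_eq h.posSemidef]
  generalize dotProduct a x + dotProduct b y = c
  rw [← add_assoc, ← add_assoc, ← add_assoc, EReal.coe_add, EReal.coe_add, EReal.coe_add, EReal.coe_add]
  refine add_le_add (add_le_add (add_le_add (add_le_add le_rfl ?_) ?_) ?_)
    (EReal.coe_le_coe_iff.2 hR)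
  · refine EReal.sum_le_coe_sum fun i _ => ?_
    -- The bound `yᵢ² ≤ Yᵢᵢ xᵢ` comes from a pair constraint, so `i` needs a partner; this is where
    -- `2 ≤ n` enters.
    obtain ⟨j, hj⟩ := exists_ne i
    exact (h.inW hj.symm).extDiv_le (hx i).1 (δ.D_psd.diag_nonneg)
  · refine EReal.sum_le_coe_sum fun p hp => EReal.coe_mul_le_coe_mul (δ.P.α_pos p hp).le ?_
    obtain ⟨h₁, h₂, h₃⟩ := pos_of_mem_coeffSet (δ.P.coeff_mem p hp)
    exact (h.inW (δ.P.ne p hp)).fPlus_le (hx _) (hx _) (hy _) (hy _) h₁ h₂ h₃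
  · refine EReal.sum_le_coe_sum fun p hp => EReal.coe_mul_le_coe_mul (δ.N.α_pos p hp).le ?_
    obtain ⟨h₁, h₂, h₃⟩ := pos_of_mem_coeffSet (δ.N.coeff_mem p hp)
    exact (h.inW (δ.N.ne p hp)).fMinus_le (hx _).1 (hx _).1 (hy _) (hy _) h₁ h₂ h₃

theorem mainTheorem7 {n : ℕ} (hn : 2 ≤ n) (a b : Fin n → ℝ) (Q : Matrix (Fin n) (Fin n) ℝ)
    (hQ : Q.PosSemidef) (δ : QuadDecomposition Q) :
    (∀ (x y : Fin n → ℝ) (Y : Matrix (Fin n) (Fin n) ℝ), OptPairsFeasible x y Y →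
      DecompFeasible x y ∧
        decompObjective δ a b x y ≤ ((optPairsObjective a b Q x y Y : ℝ) : EReal)) ∧
    decompValue δ a b ≤ optPairsValue a b Q := by
  have key (x y : Fin n → ℝ) (Y : Matrix (Fin n) (Fin n) ℝ) (h : OptPairsFeasible x y Y) :
      DecompFeasible x y ∧
        decompObjective δ a b x y ≤ ((optPairsObjective a b Q x y Y : ℝ) : EReal) :=
    ⟨⟨h.2.2.1, h.2.2.2⟩, decompObjective_le_optPairsObjective hn a b δ h⟩
  refine ⟨key, le_iInf fun x => le_iInf fun y => le_iInf fun Y => le_iInf fun h => ?_⟩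
  exact iInf_le_of_le x <| iInf_le_of_le y <| iInf_le_of_le (key x y Y h).1 (key x y Y h).2
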